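/- Let $K$ be a discrete valuation field with valuation ring $\mathcal O_K$. Then there exist a discrete valuation field $K'$ with valuation ring $\mathcal O_{K'}$ and a faithfully flat (hence local) ring homomorphism $\mathcal O_K\to\mathcal O_{K'}$ which is tangentially dominant and such that the residue field $F'$ of $\mathcal O_{K'}$ is perfect. Here, with $S=\operatorname{Spec}\mathcal O_K$, $S'=\operatorname{Spec}\mathcal O_{K'}$ and $F$ the residue field of $\mathcal O_K$, the morphism $\mathcal O_K\to\mathcal O_{K'}$ is called tangentially dominant if, for a morphism $\bar F\to\bar F'$ of algebraic closures of $F$ and $F'$ extending $F\to F'$, the ring homomorphism $$S_{\bar F}\bigl(H_1(L_{\bar F/S})\bigr)\longrightarrow S_{\bar F'}\bigl(H_1(L_{\bar F'/S'})\bigr)$$ induced by functoriality of the cotangent complex is injective, where $L_{E/S}$ denotes the cotangent complex of $\operatorname{Spec}E\to S$ and $S_E(V)$ denotes the symmetric algebra of the $E$-vector space $V$. (The condition does not depend on the choice of $\bar F\to\bar F'$.) -/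

import Mathlib

universe u v

open IsLocalRing

/-- For a commutative square of rings `A → E`, `B → E'`, `A → B`, `E → E'`, the ring homomorphism
`S(H₁(L_{E/A})) → S(H₁(L_{E'/B}))` (linear over `E`) induced by functoriality of the cotangent
complex; the symmetric algebras are taken over `E` and over `E'` respectively.
`Algebra.H1Cotangent A E` is computed from the naive cotangent complex, whose first homology
is that of the cotangent complex `L_{E/A}`. -/
noncomputable def tangentAlgebraMap (A B E E' : Type*)
    [CommRing A] [CommRing B] [CommRing E] [CommRing E']
    [Algebra A B] [Algebra A E] [Algebra B E'] [Algebra E E'] [Algebra A E']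
    [IsScalarTower A B E'] [IsScalarTower A E E'] :
    SymmetricAlgebra E (Algebra.H1Cotangent A E) →ₐ[E]
      SymmetricAlgebra E' (Algebra.H1Cotangent B E') :=
  SymmetricAlgebra.lift
    (((SymmetricAlgebra.ι E' (Algebra.H1Cotangent B E')).restrictScalars E).comp
      (Algebra.H1Cotangent.map A B E E'))

/-- A local homomorphism `A → B` of local rings, with residue fields `F → F'`, is tangentially
dominant (at the closed point of `Spec B`) if
`S(H₁(L_{E/A})) → S(H₁(L_{E'/B}))` is injective for algebraic closures `E` of `F` and `E'` of `F'`
and a morphism `E → E'` extending `F → F'`. Any two choices of `E → E'` are isomorphic; we ask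
for injectivity for all of them. The algebra structures of `E` and `E'` over `A`, `B`, `F` that
appear below are forced by the compatibilities: they are the composites of `A → F → E`,
`B → F' → E'`, `A → B → E'` and `F → F' → E'`. -/
def IsTangentiallyDominant (A : Type u) (B : Type v) [CommRing A] [CommRing B]
    [IsLocalRing A] [IsLocalRing B] [Algebra A B] [IsLocalHom (algebraMap A B)] : Prop :=
  ∀ (E : Type u) (E' : Type v) [Field E] [Field E']
    [Algebra (ResidueField A) E] [IsAlgClosure (ResidueField A) E]
    [Algebra (ResidueField B) E'] [IsAlgClosure (ResidueField B) E']
    [Algebra A E] [IsScalarTower A (ResidueField A) E]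
    [Algebra B E'] [IsScalarTower B (ResidueField B) E']
    [Algebra A E'] [IsScalarTower A B E']
    [Algebra (ResidueField A) E'] [IsScalarTower (ResidueField A) (ResidueField B) E']
    [Algebra E E'] [IsScalarTower (ResidueField A) E E'] [IsScalarTower A E E'],
    Function.Injective (tangentAlgebraMap A B E E')

/-! If the residue field `F` has characteristic zero, it is perfect and the identity works. In
characteristic `p`, choose `s i` in `O_K` whose reductions have differentials forming a basis of the
absolute differentials of `F`, and let `ϖ` be a uniformizer. Over an algebraic closure `E` of `F`,
`H₁` is spanned by the class of `ϖ` and the classes of `s i - g i ^ p`, with `g i` lifting a `p`-th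
root of `s i` (`span_frobClass_eq_top`).

Suppose that `s i = u i ^ p + ϖ * x i` in an extension where `ϖ` is still a uniformizer and whose
residue field is algebraically closed. Then these generators map to `w'` and `x i • w'`, where `w' ≠
0` is the class of `ϖ`. A linear functional with value `1` at `w'` sends them on to `T` and `x i *
T` in a polynomial ring in `T`. These are algebraically independent over `E` if the reductions of
the `x i` are so over `F`, which gives injectivity
(`isTangentiallyDominant_of_algebraicIndependent`).

To get such an extension, adjoin indeterminates `x i` and `p`-th roots `u i` of `s i - ϖ * x i`. The
`p`-independence of the reductions of the `s i`, detected by dual derivations, keeps `ϖ` a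
uniformizer (`ValuationSubring.isUniformizedBy_closure`). Inside an algebraically closed valued
field, a subfield maximal among those uniformized by `ϖ` then has algebraically closed residue field
(`IsUniformizedBy.isAlgClosed_residueField`). -/

/-! ### Generators of `H₁` over a perfect field -/

/-- An additive map satisfying the Leibniz rule and vanishing on elements whose differentials span
`Ω` is zero. -/
lemma AddMonoidHom.eq_zero_of_leibniz {A M ι : Type*} [CommRing A] [AddCommGroup M] [Module A M]
    (δ : A →+ M) (hδ : ∀ a b, δ (a * b) = a • δ b + b • δ a) (t : ι → A)
    (ht : Submodule.span A (Set.range fun i => KaehlerDifferential.D ℤ A (t i)) = ⊤)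
    (h : ∀ i, δ (t i) = 0) (a : A) : δ a = 0 := by
  let D : Derivation ℤ A M := Derivation.mk' δ.toIntLinearMap hδ
  have h0 : D.liftKaehlerDifferential = 0 := by
    refine LinearMap.ext_on_range ht fun i => ?_
    rw [Derivation.liftKaehlerDifferential_comp_D, LinearMap.zero_apply]
    exact h i
  change D a = 0
  rw [← D.liftKaehlerDifferential_comp_D, h0, LinearMap.zero_apply]

namespace Algebra.Extension

variable {R S : Type*} [CommRing R] [CommRing S] [Algebra R S]

/-- For an extension `P` of an algebra of characteristic `p`, the class in `H₁` of `a - g ^ p`,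
where `g ∈ P` lifts a `p`-th root of the image of `a`. -/
noncomputable def frobClass (P : Extension R S) (p : ℕ) [CharP S p] (a : R) (g : P.Ring)
    (h : algebraMap P.Ring S g ^ p = algebraMap R S a) : P.H1Cotangent :=
  ⟨Cotangent.mk ⟨algebraMap R P.Ring a - g ^ p, by
    rw [RingHom.mem_ker, map_sub, map_pow, h, ← IsScalarTower.algebraMap_apply, sub_self]⟩, by
    -- The differential of `a - g ^ p` is `-p * g ^ (p - 1) * dg`, and `p` vanishes in `S`.
    rw [LinearMap.mem_ker, cotangentComplex_mk]
    rw [map_sub, Derivation.map_algebraMap, Derivation.leibniz_pow, zero_sub,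
      TensorProduct.tmul_neg, ← Nat.cast_smul_eq_nsmul P.Ring, TensorProduct.tmul_smul,
      ← algebraMap_smul S (p : P.Ring), map_natCast, CharP.cast_eq_zero, zero_smul, neg_zero]⟩

/-- An element of the kernel of an extension whose class in the conormal module vanishes
lies in the square of the kernel. -/
lemma mk_eq_zero_iff (P : Extension R S) (x : P.ker) :
    Cotangent.mk x = 0 ↔ (x : P.Ring) ∈ P.ker ^ 2 := by
  rw [← Ideal.toCotangent_eq_zero]
  exact ⟨fun h => congrArg Cotangent.val h, fun h => Cotangent.ext h⟩

/-- The ideal of elements of the kernel whose class lies in a given submodule of the conormal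
module. -/
noncomputable def idealOfSubmodule (P : Extension R S) (N : Submodule S P.Cotangent) : Ideal P.Ring :=
  ((N.restrictScalars P.Ring).comap Cotangent.mk).map (Submodule.subtype _)

lemma mem_idealOfSubmodule {P : Extension R S} {N : Submodule S P.Cotangent} {f : P.Ring} :
    f ∈ P.idealOfSubmodule N ↔ ∃ hf : f ∈ P.ker, Cotangent.mk ⟨f, hf⟩ ∈ N := by
  simp [idealOfSubmodule]

lemma idealOfSubmodule_le (P : Extension R S) (N : Submodule S P.Cotangent) :
    P.idealOfSubmodule N ≤ P.ker := fun _ hf => (mem_idealOfSubmodule.mp hf).1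

lemma ker_sq_le_idealOfSubmodule (P : Extension R S) (N : Submodule S P.Cotangent) :
    P.ker ^ 2 ≤ P.idealOfSubmodule N := fun f hf => by
  have hf' : f ∈ P.ker := Ideal.pow_le_self two_ne_zero hf
  refine mem_idealOfSubmodule.mpr ⟨hf', ?_⟩
  rw [(P.mk_eq_zero_iff ⟨f, hf'⟩).mpr hf]
  exact N.zero_mem

/-- Two homs of extensions agree on `H₁`; if the second kills a representative `y` of a class in
`H₁`, the first maps `y` to the square of the kernel. -/
lemma Hom.apply_mem_ker_sq {P Q : Extension R S} (f₁ f₂ : P.Hom Q) (y : P.ker)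
    (hy : Cotangent.mk y ∈ LinearMap.ker P.cotangentComplex) (h : f₂.toRingHom y = 0) :
    f₁.toRingHom y ∈ Q.ker ^ 2 := by
  have key : Cotangent.map f₁ (Cotangent.mk y) = Cotangent.map f₂ (Cotangent.mk y) :=
    congrArg (fun φ => (φ (⟨_, hy⟩ : P.H1Cotangent)).1) (H1Cotangent.map_eq f₁ f₂)
  rw [Cotangent.map_mk, Cotangent.map_mk, (mk_eq_zero_iff Q ⟨f₂.toAlgHom y, _⟩).mpr
    (by simp [h])] at key
  exact (mk_eq_zero_iff Q _).mp key

/-- If `J` is the ideal attached to a submodule `N` of the conormal module and `P ⧸ J → S` has a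
section of `R`-algebras, then `N` contains `H₁`. -/
lemma H1Cotangent.mem_of_section (P : Extension R S) (N : Submodule S P.Cotangent)
    (τ : S →+* P.Ring ⧸ P.idealOfSubmodule N)
    (hτ : ∀ s, ∃ g : P.Ring, algebraMap P.Ring S g = s ∧ τ s = Ideal.Quotient.mk _ g)
    (hτR : ∀ a : R, τ (algebraMap R S a) = Ideal.Quotient.mk _ (algebraMap R P.Ring a))
    (x : P.H1Cotangent) : x.1 ∈ N := by
  let π : P.Ring ⧸ P.idealOfSubmodule N →ₐ[R] S :=
    Ideal.Quotient.liftₐ _ (IsScalarTower.toAlgHom R P.Ring S)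
      (fun a ha => P.idealOfSubmodule_le N ha)
  have hπs : Function.Surjective π := fun s => ⟨Ideal.Quotient.mk _ (P.σ s), P.algebraMap_σ s⟩
  -- Two homs from `P` to `Q = P ⧸ J` are compared: the quotient map, and the structure map followed
  -- by the section. The second kills the kernel of `P`, and the kernel of `Q` has square zero, so a
  -- representative of a class in `H₁` must lie in `J`.
  let Q : Extension R S := ofSurjective π hπs
  let f₁ : P.Hom Q := ⟨Ideal.Quotient.mk _, fun a => rfl, fun a => rfl⟩
  let f₂ : P.Hom Q := ⟨τ.comp (algebraMap P.Ring S), fun a => by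
      refine Eq.trans ?_ (hτR a)
      exact congrArg τ (IsScalarTower.algebraMap_apply R P.Ring S a).symm, fun a => by
      obtain ⟨g, hg, hg'⟩ := hτ (algebraMap P.Ring S a)
      refine (congrArg π hg').trans hg⟩
  obtain ⟨y, hyx⟩ := Cotangent.mk_surjective x.1
  have h3 : (Ideal.Quotient.mk _ (y : P.Ring) : Q.Ring) ∈ Q.ker ^ 2 :=
    Hom.apply_mem_ker_sq f₁ f₂ y (hyx ▸ x.2)
      ((congrArg τ (RingHom.mem_ker.mp y.2)).trans τ.map_zero)
  have h4 : Q.ker ^ 2 ≤ ⊥ := by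
    rw [pow_two, Ideal.mul_le]
    intro r hr s hs
    obtain ⟨r, rfl⟩ := Ideal.Quotient.mk_surjective r
    obtain ⟨s, rfl⟩ := Ideal.Quotient.mk_surjective s
    refine Ideal.Quotient.eq_zero_iff_mem.mpr (P.ker_sq_le_idealOfSubmodule N ?_)
    rw [pow_two]
    exact Ideal.mul_mem_mul hr hs
  obtain ⟨_, h6⟩ := mem_idealOfSubmodule.mp (Ideal.Quotient.eq_zero_iff_mem.mp (h4 h3))
  rwa [← hyx]

/-- Let `S` be a perfect field of characteristic `p` over a local ring `R` with principal maximal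
ideal `(ϖ)`. If the differentials of the reductions of `s i` span the differentials of the residue
field, then `H₁` is spanned by the class of `ϖ` and the classes attached to the `s i`. -/
theorem span_frobClass_eq_top {R S ι : Type*} [CommRing R] [IsLocalRing R] [Field S]
    [Algebra R S] [Algebra (ResidueField R) S] [IsScalarTower R (ResidueField R) S]
    (p : ℕ) [Fact p.Prime] [CharP S p] [PerfectRing S p]
    (ϖ : R) (hϖ : maximalIdeal R = Ideal.span {ϖ}) (s : ι → R)
    (hs : Submodule.span (ResidueField R)
      (Set.range fun i => KaehlerDifferential.D ℤ (ResidueField R) (residue R (s i))) = ⊤)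
    (P : Extension R S) (N : Submodule S P.H1Cotangent)
    (hϖN : ∀ h, P.frobClass p ϖ 0 h ∈ N)
    (hsN : ∀ i, ∃ g h, P.frobClass p (s i) g h ∈ N) : N = ⊤ := by
  have hp : p.Prime := Fact.out
  set N' : Submodule S P.Cotangent := N.map h1Cotangentι with hN'
  set J := P.idealOfSubmodule N' with hJ
  have hRS : ∀ a ∈ maximalIdeal R, algebraMap R S a = 0 := fun a ha => by
    rw [IsScalarTower.algebraMap_apply R (ResidueField R) S, ResidueField.algebraMap_eq,
      (residue_eq_zero_iff a).mpr ha, map_zero]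
  have hfrob : ∀ a g h, P.frobClass p a g h ∈ N →
      Ideal.Quotient.mk J (algebraMap R P.Ring a) = Ideal.Quotient.mk J g ^ p := by
    intro a g h hN
    rw [← map_pow, Ideal.Quotient.eq]
    exact mem_idealOfSubmodule.mpr ⟨by
      rw [RingHom.mem_ker, map_sub, map_pow, h, ← IsScalarTower.algebraMap_apply, sub_self],
      Submodule.mem_map_of_mem hN⟩
  have hϖ0 : algebraMap R S ϖ = 0 := hRS ϖ (hϖ ▸ Ideal.mem_span_singleton_self ϖ)
  have hϖJ : Ideal.Quotient.mk J (algebraMap R P.Ring ϖ) = 0 := by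
    rw [hfrob ϖ 0 (by simp [hϖ0, hp.ne_zero]) (hϖN _), map_zero, zero_pow hp.ne_zero]
  have hmJ : ∀ a ∈ maximalIdeal R, Ideal.Quotient.mk J (algebraMap R P.Ring a) = 0 := by
    intro a ha
    rw [hϖ, Ideal.mem_span_singleton] at ha
    obtain ⟨b, rfl⟩ := ha
    rw [map_mul, map_mul, hϖJ, zero_mul]
  have hpR : (p : R) ∈ maximalIdeal R := by
    rw [← residue_eq_zero_iff]
    apply (algebraMap (ResidueField R) S).injective
    simp
  have hpQ : (p : P.Ring ⧸ J) = 0 := by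
    rw [← hmJ _ hpR, map_natCast, map_natCast]
  let π : P.Ring ⧸ J →+* S := Ideal.Quotient.lift J (algebraMap P.Ring S)
    (fun a ha => P.idealOfSubmodule_le N' ha)
  have : Nontrivial (P.Ring ⧸ J) := π.domain_nontrivial
  have : CharP (P.Ring ⧸ J) p := (CharP.charP_iff_prime_eq_zero hp).mpr hpQ
  have hsq : ∀ a b : P.Ring ⧸ J, π a = 0 → π b = 0 → a * b = 0 := by
    intro a b ha hb
    obtain ⟨a, rfl⟩ := Ideal.Quotient.mk_surjective a
    obtain ⟨b, rfl⟩ := Ideal.Quotient.mk_surjective b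
    rw [← map_mul, Ideal.Quotient.eq_zero_iff_mem]
    refine P.ker_sq_le_idealOfSubmodule N' ?_
    rw [pow_two]
    exact Ideal.mul_mem_mul ha hb
  -- The kernel of `P ⧸ J → S` has square zero, so Frobenius on `P ⧸ J` kills it and factors through
  -- `S`. Precomposing with the inverse Frobenius of the perfect field `S` yields a ring section
  -- `τ`.
  let φ : S →+* P.Ring ⧸ J := RingHom.liftOfSurjective (algebraMap P.Ring S)
    P.algebraMap_surjective ⟨(frobenius _ p).comp (Ideal.Quotient.mk J), by
      intro f hf
      obtain ⟨k, rfl⟩ : ∃ k, p = 2 + k := Nat.exists_eq_add_of_le hp.two_le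
      rw [RingHom.mem_ker, RingHom.comp_apply, frobenius_def, pow_add, pow_two,
        hsq (Ideal.Quotient.mk J f) (Ideal.Quotient.mk J f) hf hf, zero_mul]⟩
  have hφ : ∀ f, φ (algebraMap P.Ring S f) = Ideal.Quotient.mk J f ^ p := fun f =>
    RingHom.liftOfRightInverse_comp_apply _ _ _ _ _
  let τ : S →+* P.Ring ⧸ J := φ.comp (frobeniusEquiv S p).symm.toRingHom
  have hτ : ∀ g : P.Ring, τ (algebraMap P.Ring S g ^ p) = Ideal.Quotient.mk J g ^ p := by
    intro g
    rw [← hφ]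
    exact congrArg φ (frobeniusEquiv_symm_apply_frobenius S p _)
  have hτ' : ∀ s, ∃ g : P.Ring, algebraMap P.Ring S g = s ∧ τ s = Ideal.Quotient.mk _ g := by
    intro s
    obtain ⟨t, rfl⟩ := (frobeniusEquiv S p).surjective s
    obtain ⟨g, rfl⟩ := P.algebraMap_surjective t
    exact ⟨g ^ p, by rw [map_pow, frobeniusEquiv_def], by
      rw [frobeniusEquiv_def, hτ, map_pow]⟩
  have hπτ : ∀ s, π (τ s) = s := fun s => by
    obtain ⟨g, hg, hg'⟩ := hτ' s
    rw [hg']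
    exact hg
  let j : ResidueField R →+* P.Ring ⧸ J :=
    Ideal.Quotient.lift _ ((Ideal.Quotient.mk J).comp (algebraMap R P.Ring)) hmJ
  have hj : ∀ a, j (residue R a) = Ideal.Quotient.mk J (algebraMap R P.Ring a) := fun a => rfl
  have hπj : ∀ a, π (j a) = algebraMap _ S a := by
    intro a
    obtain ⟨a, rfl⟩ := residue_surjective a
    rw [hj, ← ResidueField.algebraMap_eq, ← IsScalarTower.algebraMap_apply,
      IsScalarTower.algebraMap_apply R P.Ring S]
    rfl
  let i : ResidueField R →+* P.Ring ⧸ J := τ.comp (algebraMap (ResidueField R) S)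
  have hπi : ∀ a, π (i a) = algebraMap _ S a := fun a => hπτ _
  let : Module (ResidueField R) (P.Ring ⧸ J) := Module.compHom _ i
  -- Both `j` and `i` lift the map from the residue field to `S` across a square-zero ideal, so `j -
  -- i` is a derivation. It vanishes at the reduction of `s k`, because `s k` becomes `g ^ p` modulo
  -- `J` and `τ` is given by `p`-th powers of lifts. Equality makes `τ` linear over `R`.
  have hδ : ∀ a, j a = i a := by
    intro a
    refine sub_eq_zero.mp ((j.toAddMonoidHom - i.toAddMonoidHom).eq_zero_of_leibniz
      (fun a b => ?_) _ hs (fun k => ?_) a)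
    · change j (a * b) - i (a * b) = i a * (j b - i b) + i b * (j a - i a)
      have := hsq (j a - i a) (j b - i b) (by simp [hπi, hπj]) (by simp [hπi, hπj])
      rw [map_mul, map_mul]
      linear_combination this
    · change j (residue R (s k)) - i (residue R (s k)) = 0
      obtain ⟨g, h, hN⟩ := hsN k
      rw [sub_eq_zero, hj, hfrob _ _ h hN, ← hτ, h,
        IsScalarTower.algebraMap_apply R (ResidueField R) S]
      rfl
  refine Submodule.eq_top_iff'.mpr fun x => ?_
  obtain ⟨y, hy, hyx⟩ := H1Cotangent.mem_of_section P N' τ hτ' (fun a => by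
    rw [IsScalarTower.algebraMap_apply R (ResidueField R) S]
    exact (hδ _).symm) x
  rwa [← h1Cotangentι_injective hyx]

end Algebra.Extension

/-! ### Injectivity on symmetric algebras -/

/-- If the `y i` are algebraically independent over `E`, then so are `T` and the `y i * T`. -/
lemma AlgebraicIndependent.option_elim_X_mul {ι E A : Type*} [Field E] [CommRing A] [Algebra E A]
    {y : ι → A} (hy : AlgebraicIndependent E y) :
    AlgebraicIndependent E (fun o : Option ι =>
      o.elim (Polynomial.X : Polynomial A) fun i => Polynomial.C (y i) * Polynomial.X) := by
  -- The substitution is first done with generic variables, where it can be undone by dividing by `X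
  -- none` in the fraction field; the given family is `σ` followed by an injective map.
  let σ : MvPolynomial (Option ι) E →ₐ[E] MvPolynomial (Option ι) E :=
    MvPolynomial.aeval fun o : Option ι => o.elim (MvPolynomial.X none)
      fun i => MvPolynomial.X (some i) * MvPolynomial.X none
  let Q := FractionRing (MvPolynomial (Option ι) E)
  let x : Option ι → Q := fun o => algebraMap (MvPolynomial (Option ι) E) Q (MvPolynomial.X o)
  have hx : x none ≠ 0 := by
    simp [x]
  let ρ : MvPolynomial (Option ι) E →ₐ[E] Q :=
    MvPolynomial.aeval fun o : Option ι => o.elim (x none) fun i => x (some i) * (x none)⁻¹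
  have hρσ : ρ.comp σ = IsScalarTower.toAlgHom E _ Q := by
    refine MvPolynomial.algHom_ext fun o => ?_
    cases o with
    | none => simp [σ, ρ, x]
    | some i => 
      simp only [AlgHom.comp_apply, σ, ρ, MvPolynomial.aeval_X, Option.elim, map_mul]
      rw [mul_assoc, inv_mul_cancel₀ hx, mul_one]
      rfl
  have hσ : Function.Injective σ := by
    have : Function.Injective (ρ.comp σ) := by
      rw [hρσ]
      exact IsFractionRing.injective (MvPolynomial (Option ι) E) Q
    exact Function.Injective.of_comp (f := ρ) (g := σ) this
  have hcomp : MvPolynomial.aeval (fun o : Option ι =>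
      o.elim (Polynomial.X : Polynomial A) fun i => Polynomial.C (y i) * Polynomial.X) =
      ((Polynomial.mapAlgHom (MvPolynomial.aeval y)).comp
        (MvPolynomial.optionEquivLeft E ι).toAlgHom).comp σ := by
    refine MvPolynomial.algHom_ext fun o => ?_
    cases o with
    | none => simp [σ]
    | some i => simp [σ]
  rw [AlgebraicIndependent, hcomp]
  have hmap : Function.Injective (Polynomial.mapAlgHom (MvPolynomial.aeval (R := E) y)) :=
    Polynomial.map_injective _ hy
  exact (hmap.comp (MvPolynomial.optionEquivLeft E ι).injective).comp hσ

/-- A nonzero vector takes the value `1` under some linear functional. -/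
lemma Module.exists_dual_apply_eq_one {k V : Type*} [Field k] [AddCommGroup V] [Module k V] {v : V}
    (hv : v ≠ 0) : ∃ ℓ : V →ₗ[k] k, ℓ v = 1 := by
  obtain ⟨φ, hφ⟩ : ∃ φ : Module.Dual k V, φ v ≠ 0 := by
    by_contra! h
    exact hv ((Module.forall_dual_apply_eq_zero_iff k v).mp h)
  exact ⟨(φ v)⁻¹ • φ, by simp [hφ]⟩

namespace Algebra.Extension

/-- The cofactor of `g - g'` in `g ^ p - g' ^ p` has image `p` times a power, which is zero in `S`,
so both factors lie in the kernel. Hence Frobenius classes do not depend on the chosen lift of the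
`p`-th root. -/
lemma pow_sub_pow_mem_ker_sq {R S : Type*} [CommRing R] [CommRing S] [Algebra R S]
    (P : Extension R S) (p : ℕ) [CharP S p] (g g' : P.Ring)
    (h : algebraMap P.Ring S g = algebraMap P.Ring S g') : g ^ p - g' ^ p ∈ P.ker ^ 2 := by
  rw [← Commute.geom_sum₂_mul (Commute.all g g') p, pow_two]
  refine Ideal.mul_mem_mul ?_ (by rw [RingHom.mem_ker, map_sub, h, sub_self])
  rw [RingHom.mem_ker]
  simp only [map_sum, map_mul, map_pow, h]
  rw [geom_sum₂_self, CharP.cast_eq_zero, zero_mul]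

/-- Since `p`-th roots in `S` are unique, `g` and `u` have the same image, so `g ^ p` may be
replaced by `u ^ p` modulo the square of the kernel, leaving `ϖ * x`. This is what collapses the
generators to multiples of a single class. -/
lemma frobClass_pow_add_mul {R S : Type*} [CommRing R] [Field S] [Algebra R S]
    (P : Extension R S) (p : ℕ) [Fact p.Prime] [CharP S p] (u ϖ x : R) (g : P.Ring)
    (h : algebraMap P.Ring S g ^ p = algebraMap R S (u ^ p + ϖ * x))
    (hϖ : algebraMap P.Ring S 0 ^ p = algebraMap R S ϖ) :
    P.frobClass p (u ^ p + ϖ * x) g h = algebraMap R S x • P.frobClass p ϖ 0 hϖ := by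
  have hp : p ≠ 0 := (Fact.out : p.Prime).ne_zero
  have hϖ0 : algebraMap R S ϖ = 0 := by rw [← hϖ, map_zero, zero_pow hp]
  have hgu : algebraMap P.Ring S (algebraMap R P.Ring u) = algebraMap P.Ring S g := by
    apply frobenius_inj S p
    rw [frobenius_def, frobenius_def, h, ← IsScalarTower.algebraMap_apply]
    simp [hϖ0]
  apply h1Cotangentι_injective
  rw [map_smul, IsScalarTower.algebraMap_apply R P.Ring S, algebraMap_smul]
  change Cotangent.mk _ = algebraMap R P.Ring x • Cotangent.mk _
  rw [← map_smul, ← sub_eq_zero, ← map_sub, mk_eq_zero_iff]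
  convert! P.pow_sub_pow_mem_ker_sq p _ _ hgu using 1
  simp [hp, Algebra.smul_def]
  ring

/-- If a local ring `R` surjects onto the field `S` and `ϖ` is in the maximal ideal
but not in its square, then the class of `ϖ` in `H₁` does not vanish. -/
lemma frobClass_ne_zero {R S : Type*} [CommRing R] [IsLocalRing R] [Field S] [Algebra R S]
    (hRS : Function.Surjective (algebraMap R S)) (p : ℕ) [Fact p.Prime] [CharP S p] (ϖ : R)
    (hϖ2 : ϖ ∉ maximalIdeal R ^ 2) (hϖ) :
    (Generators.self R S).toExtension.frobClass p ϖ 0 hϖ ≠ 0 := by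
  intro h0
  have hp : p ≠ 0 := (Fact.out : p.Prime).ne_zero
  have hker : RingHom.ker (algebraMap R S) = maximalIdeal R :=
    eq_maximalIdeal (RingHom.ker_isMaximal_of_surjective _ hRS)
  -- The class is tested in the extension `R ⧸ 𝔪 ^ 2` of `S`, whose kernel has square zero: there
  -- its vanishing means that `ϖ` lies in `𝔪 ^ 2`.
  let π : R ⧸ maximalIdeal R ^ 2 →ₐ[R] S := Ideal.Quotient.liftₐ _ (Algebra.ofId R S)
    (fun a ha => by
      have : a ∈ RingHom.ker (algebraMap R S) := hker ▸ Ideal.pow_le_self two_ne_zero ha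
      exact this)
  have hπ : Function.Surjective π := fun s => by
    obtain ⟨r, rfl⟩ := hRS s
    exact ⟨Ideal.Quotient.mk _ r, rfl⟩
  let Q : Extension R S := ofSurjective π hπ
  have h1 := congrArg (H1Cotangent.map Q.defaultHom) h0
  rw [map_zero] at h1
  have h2 : Cotangent.map Q.defaultHom (Cotangent.mk ⟨_, _⟩) = 0 := congrArg (fun t => t.1) h1
  rw [Cotangent.map_mk, mk_eq_zero_iff] at h2
  have h4 : Q.ker ^ 2 ≤ ⊥ := by
    rw [pow_two, Ideal.mul_le]
    intro r hr s hs
    obtain ⟨r, rfl⟩ := Ideal.Quotient.mk_surjective r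
    obtain ⟨s, rfl⟩ := Ideal.Quotient.mk_surjective s
    refine Ideal.Quotient.eq_zero_iff_mem.mpr ?_
    rw [pow_two]
    refine Ideal.mul_mem_mul ?_ ?_
    · rw [← hker]; exact hr
    · rw [← hker]; exact hs
  have h3 : Q.defaultHom.toAlgHom (algebraMap R _ ϖ - 0 ^ p) = 0 := h4 h2
  rw [map_sub, map_pow, map_zero, zero_pow hp, sub_zero, AlgHom.commutes] at h3
  exact hϖ2 (Ideal.Quotient.eq_zero_iff_mem.mp h3)

end Algebra.Extension

open Algebra Extension in
/-- A local homomorphism of local rings whose maximal ideals are generated by the same element `ϖ`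
is tangentially dominant if the residue field of the target is algebraically closed and
`s i = u i ^ p + ϖ * x i`, where the differentials of the reductions of the `s i` span the
differentials of the residue field and the reductions of the `x i` are algebraically
independent. -/
theorem isTangentiallyDominant_of_algebraicIndependent {A : Type u} {B : Type v} [CommRing A]
    [CommRing B] [IsLocalRing A] [IsLocalRing B] [Algebra A B] [IsLocalHom (algebraMap A B)]
    [IsAlgClosed (ResidueField B)] (p : ℕ) [Fact p.Prime] [CharP (ResidueField A) p]
    (ϖ : A) (hϖ : maximalIdeal A = Ideal.span {ϖ})
    (hϖ2 : algebraMap A B ϖ ∉ maximalIdeal B ^ 2)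
    {ι : Type*} (s : ι → A) (x u : ι → B)
    (hs : Submodule.span (ResidueField A)
      (Set.range fun i => KaehlerDifferential.D ℤ (ResidueField A) (residue A (s i))) = ⊤)
    (hx : AlgebraicIndependent (ResidueField A) fun i => residue B (x i))
    (hsx : ∀ i, algebraMap A B (s i) = u i ^ p + algebraMap A B ϖ * x i) :
    IsTangentiallyDominant A B := by
  intro E E' _ _ _ _ _ _ _ _ _ _ _ _ _ _ _ _ _
  have hp : p ≠ 0 := (Fact.out : p.Prime).ne_zero
  have : CharP E p := charP_of_injective_algebraMap (algebraMap (ResidueField A) E).injective p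
  have : CharP E' p := charP_of_injective_algebraMap (algebraMap E E').injective p
  have : IsAlgClosed E := IsAlgClosure.isAlgClosed (ResidueField A)
  have : Algebra.IsAlgebraic (ResidueField A) E := IsAlgClosure.isAlgebraic
  have : Algebra.IsAlgebraic (ResidueField B) E' := IsAlgClosure.isAlgebraic
  have hBE : Function.Surjective (algebraMap B E') := by
    rw [IsScalarTower.algebraMap_eq B (ResidueField B) E']
    exact (IsAlgClosed.algebraMap_bijective_of_isIntegral
      (k := ResidueField B) (K := E')).2.comp residue_surjective
  have hϖE : algebraMap A E ϖ = 0 := by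
    rw [IsScalarTower.algebraMap_apply A (ResidueField A) E, ResidueField.algebraMap_eq,
      (residue_eq_zero_iff ϖ).mpr (hϖ ▸ Ideal.mem_span_singleton_self ϖ), map_zero]
  have hE'E : ∀ a, algebraMap B E' (algebraMap A B a) = algebraMap E E' (algebraMap A E a) :=
    fun a => by rw [← IsScalarTower.algebraMap_apply, ← IsScalarTower.algebraMap_apply]
  set P := (Generators.self A E).toExtension with hP
  set P' := (Generators.self B E').toExtension with hP'
  let f : P.Hom P' := (Generators.defaultHom _ _).toExtensionHom
  have hf : H1Cotangent.map A B E E' = Extension.H1Cotangent.map f := rfl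
  have hg : ∀ i, ∃ g : P.Ring, algebraMap P.Ring E g ^ p = algebraMap A E (s i) := by
    intro i
    obtain ⟨c, hc⟩ := IsAlgClosed.exists_pow_nat_eq (algebraMap A E (s i)) (Nat.pos_of_ne_zero hp)
    exact ⟨P.σ c, by rw [P.algebraMap_σ, hc]⟩
  choose g hg using hg
  have hϖ' : algebraMap P.Ring E 0 ^ p = algebraMap A E ϖ := by
    rw [map_zero, zero_pow hp, hϖE]
  have hϖ'' : algebraMap P'.Ring E' 0 ^ p = algebraMap B E' (algebraMap A B ϖ) := by
    rw [map_zero, zero_pow hp, hE'E, hϖE, map_zero]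
  let w : Option ι → H1Cotangent A E := fun o =>
    o.elim (P.frobClass p ϖ 0 hϖ') fun i => P.frobClass p (s i) (g i) (hg i)
  have hw : Submodule.span E (Set.range w) = ⊤ :=
    span_frobClass_eq_top p ϖ hϖ s hs P _
      (fun _ => Submodule.subset_span ⟨none, rfl⟩)
      (fun i => ⟨g i, hg i, Submodule.subset_span ⟨some i, rfl⟩⟩)
  let w' := P'.frobClass p (algebraMap A B ϖ) 0 hϖ''
  have hw' : w' ≠ 0 := frobClass_ne_zero hBE p _ hϖ2 _
  have hmap : ∀ a g h, ∃ h', Extension.H1Cotangent.map f (P.frobClass p a g h) =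
      P'.frobClass p (algebraMap A B a) (f.toRingHom g) h' := by
    intro a g h
    refine ⟨by rw [f.algebraMap_toRingHom, ← map_pow, h, hE'E], ?_⟩
    apply h1Cotangentι_injective
    change Cotangent.map f (Cotangent.mk _) = Cotangent.mk _
    rw [Cotangent.map_mk]
    congr 2
    simp
  have hmap_none : H1Cotangent.map A B E E' (w none) = w' := by
    obtain ⟨h', hh⟩ := hmap ϖ 0 hϖ'
    exact hh
  have hmap_some : ∀ i, H1Cotangent.map A B E E' (w (some i)) = algebraMap B E' (x i) • w' := by
    intro i
    obtain ⟨h', hh⟩ := hmap (s i) (g i) (hg i)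
    rw [hf]
    refine hh.trans ?_
    have h'' := h'
    rw [hsx i] at h''
    rw [← P'.frobClass_pow_add_mul p (u i) _ (x i) _ h'']
    congr 1
    exact hsx i
  have hy : AlgebraicIndependent E fun i => algebraMap B E' (x i) := by
    have h1 := hx.map' (f := IsScalarTower.toAlgHom (ResidueField A) (ResidueField B) E')
      (algebraMap (ResidueField B) E').injective
    have h2 : (fun i => algebraMap B E' (x i)) =
        IsScalarTower.toAlgHom (ResidueField A) (ResidueField B) E' ∘ fun i => residue B (x i) := by
      funext i
      rw [IsScalarTower.algebraMap_apply B (ResidueField B) E']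
      rfl
    rw [h2]
    -- Independence over the residue field persists over `E`, which is algebraic over it.
    exact h1.extendScalars E
  obtain ⟨ℓ, hℓ⟩ := Module.exists_dual_apply_eq_one (k := E') hw'
  let θ : SymmetricAlgebra E' (H1Cotangent B E') →ₐ[E'] Polynomial E' :=
    SymmetricAlgebra.lift ((LinearMap.toSpanSingleton E' (Polynomial E') Polynomial.X).comp ℓ)
  -- As `Ψ` is surjective, injectivity of the composite starting with `Ψ` suffices; linear
  -- independence of the `w o` need not be known beforehand.
  let Ψ : MvPolynomial (Option ι) E →ₐ[E] SymmetricAlgebra E (H1Cotangent A E) :=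
    MvPolynomial.aeval fun o => SymmetricAlgebra.ι E _ (w o)
  have hΨ : Function.Surjective Ψ := by
    have hι : ∀ m : H1Cotangent A E, SymmetricAlgebra.ι E _ m ∈ Ψ.range := by
      intro m
      have hm : m ∈ Submodule.span E (Set.range w) := hw ▸ Submodule.mem_top
      have hle : Submodule.span E (Set.range w) ≤
          Ψ.range.toSubmodule.comap (SymmetricAlgebra.ι E (H1Cotangent A E)) := by
        rw [Submodule.span_le]
        rintro _ ⟨o, rfl⟩
        exact ⟨MvPolynomial.X o, MvPolynomial.aeval_X _ _⟩
      exact hle hm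
    intro z
    change z ∈ Ψ.range
    induction z using SymmetricAlgebra.induction with
    | algebraMap r => exact Subalgebra.algebraMap_mem _ r
    | ι m => exact hι m
    | mul a b ha hb => exact Subalgebra.mul_mem _ ha hb
    | add a b ha hb => exact Subalgebra.add_mem _ ha hb
  have hcomp : ((θ.restrictScalars E).comp (tangentAlgebraMap A B E E')).comp Ψ =
      MvPolynomial.aeval (fun o : Option ι => o.elim (Polynomial.X : Polynomial E') fun i =>
        Polynomial.C (algebraMap B E' (x i)) * Polynomial.X) := by
    refine MvPolynomial.algHom_ext fun o => ?_
    have h1 : ((θ.restrictScalars E).comp (tangentAlgebraMap A B E E')).comp Ψ (MvPolynomial.X o) =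
        ℓ (H1Cotangent.map A B E E' (w o)) • (Polynomial.X : Polynomial E') := by
      simp [Ψ, θ, tangentAlgebraMap]
    rw [h1, MvPolynomial.aeval_X]
    cases o with
    | none => rw [hmap_none, hℓ, one_smul]; rfl
    | some i => rw [hmap_some, map_smul, hℓ, smul_eq_mul, mul_one, Polynomial.smul_eq_C_mul]; rfl
  have hinj : Function.Injective
      (((θ.restrictScalars E).comp (tangentAlgebraMap A B E E')).comp Ψ) := by
    rw [hcomp]
    exact hy.option_elim_X_mul
  intro a b hab
  obtain ⟨a, rfl⟩ := hΨ a
  obtain ⟨b, rfl⟩ := hΨ b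
  rw [hinj (congrArg θ hab)]

/-! ### `p`-independence via dual derivations -/

namespace MvPolynomial

/-- A derivation maps the value of `f` at `t`, with coefficients raised to the `p`-th power, to the
value of the partial derivative, if it is dual to the family `t`. -/
lemma derivation_eval₂_frobenius {F ι : Type*} [CommRing F] (p : ℕ) [Fact p.Prime] [CharP F p]
    [DecidableEq ι] (t : ι → F) (i : ι) (d : Derivation ℤ F F)
    (hd : ∀ j, d (t j) = if j = i then 1 else 0) (f : MvPolynomial ι F) :
    d (eval₂ (frobenius F p) t f) = eval₂ (frobenius F p) t (pderiv i f) := by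
  induction f using MvPolynomial.induction_on with
  | C a => simp [frobenius_def, Derivation.leibniz_pow]
  | add f g hf hg => simp [hf, hg]
  | mul_X f j hf =>
    rw [eval₂_mul, Derivation.leibniz, hf, pderiv_mul, eval₂_add, eval₂_mul, eval₂_mul, eval₂_X,
      hd, pderiv_X, smul_eq_mul, smul_eq_mul]
    by_cases h : j = i
    · subst h; simp; ring
    · simp [h, mul_comm]

/-- A family with a dual family of derivations is `p`-independent. -/
lemma eq_zero_of_eval₂_frobenius_eq_zero {F ι : Type*} [CommRing F] [IsDomain F] (p : ℕ)
    [Fact p.Prime] [CharP F p] [DecidableEq ι] (t : ι → F) (d : ι → Derivation ℤ F F)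
    (hd : ∀ i j, d i (t j) = if j = i then 1 else 0) (f : MvPolynomial ι F)
    (hf : ∀ m ∈ f.support, ∀ i, m i < p) (h : eval₂ (frobenius F p) t f = 0) : f = 0 := by
  have hp : p.Prime := Fact.out
  -- Applying `d i` to a relation gives the relation of its partial derivative, of smaller degree.
  -- By induction all partial derivatives vanish, and exponents below `p` then force `f` to be
  -- constant.
  induction hn : f.totalDegree using Nat.strong_induction_on generalizing f with
  | _ n ih =>
  have hpd : ∀ i, pderiv i f = 0 := by
    intro i
    by_contra h0
    have hsupp : ∀ m ∈ (pderiv i f).support, m + Finsupp.single i 1 ∈ f.support := by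
      intro m hm
      rw [mem_support_iff, coeff_pderiv] at hm
      rw [mem_support_iff]
      exact left_ne_zero_of_mul hm
    refine h0 (ih _ ?_ (pderiv i f) (fun m hm j => ?_) ?_ rfl)
    · rw [← hn]
      obtain ⟨m, hm, hmd⟩ := (pderiv i f).support.exists_mem_eq_sup
        (support_nonempty.mpr h0) (fun s => s.sum fun _ e => e)
      have h1 := le_totalDegree (hsupp m hm)
      rw [Finsupp.sum_add_index' (by simp) (by simp)] at h1
      have h2 : (pderiv i f).totalDegree = m.sum fun _ e => e := hmd
      rw [Finsupp.sum_single_index rfl] at h1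
      omega
    · have := hf _ (hsupp m hm) j
      rw [Finsupp.add_apply] at this
      omega
    · rw [← derivation_eval₂_frobenius p t i (d i) (hd i), h, map_zero]
  have hC : f = C (coeff 0 f) := by
    ext m
    rw [coeff_C]
    split_ifs with hm
    · rw [hm]
    · obtain ⟨i, hi⟩ : ∃ i, m i ≠ 0 := by
        by_contra! h0
        exact hm (Finsupp.ext h0).symm
      have h1 := coeff_pderiv (i := i) f (m - Finsupp.single i 1)
      rw [hpd, coeff_zero, tsub_add_cancel_of_le (by simpa using Nat.one_le_iff_ne_zero.mpr hi)]
        at h1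
      by_contra h2
      have h3 : ((m i : ℕ) : F) = 0 := by
        have := (mul_eq_zero.mp h1.symm).resolve_left h2
        rw [← this]
        simp only [Finsupp.tsub_apply, Finsupp.single_eq_same]
        rw [← Nat.cast_add_one, Nat.sub_add_cancel (Nat.one_le_iff_ne_zero.mpr hi)]
      rw [CharP.cast_eq_zero_iff F p] at h3
      exact absurd (Nat.le_of_dvd (Nat.pos_of_ne_zero hi) h3)
        (not_le.mpr (hf m (mem_support_iff.mpr h2) i))
  rw [hC, eval₂_C, frobenius_def] at h
  rw [hC, pow_eq_zero_iff hp.ne_zero |>.mp h, C_0]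

/-- If `t` is `p`-independent in `F`, if `u` consists of `p`-th roots of the `t i` in a field
extension `k` of `F` and if `y` is algebraically independent over `F`, then a nonzero polynomial in
`u` and `y` that has degree less than `p` in each `u i` does not vanish. -/
lemma eq_zero_of_eval₂_aeval_eq_zero {F k ι κ : Type*} [Field F] [Field k] [Algebra F k] (p : ℕ)
    [Fact p.Prime] [CharP F p] [DecidableEq ι] (t : ι → F) (d : ι → Derivation ℤ F F)
    (hd : ∀ i j, d i (t j) = if j = i then 1 else 0) (u : ι → k)
    (hu : ∀ i, u i ^ p = algebraMap F k (t i)) (y : κ → k) (hy : AlgebraicIndependent F y)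
    (f : MvPolynomial ι (MvPolynomial κ F)) (hf : ∀ m ∈ f.support, ∀ i, m i < p)
    (h : eval₂ (aeval y : MvPolynomial κ F →ₐ[F] k).toRingHom u f = 0) : f = 0 := by
  have hp : p.Prime := Fact.out
  have : CharP k p := charP_of_injective_algebraMap (algebraMap F k).injective p
  -- The `p`-th power of the relation involves only the `t i` and the `y`, so independence of `y`
  -- lifts it to the polynomial ring over `F`.
  have h1 : eval₂ (frobenius (MvPolynomial κ F) p) (fun i => C (t i)) f = 0 := by
    apply hy
    rw [map_zero]
    have h2 := congrArg (frobenius k p) h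
    rw [map_zero, hom_eval₂] at h2
    rw [← h2]
    refine (hom_eval₂ f (frobenius (MvPolynomial κ F) p) (aeval y).toRingHom _).trans ?_
    congr 1
    · ext <;> simp [frobenius_def]
    · funext i
      simp [frobenius_def, hu]
  -- Only exponents of the form `p • b` occur after Frobenius; each such coefficient is a relation
  -- among the `t i` alone.
  have h3 : ∀ b : κ →₀ ℕ, ∑ m ∈ f.support, monomial m (coeff b (coeff m f)) = 0 := by
    intro b
    have hcoeff : ∀ m, coeff m (∑ m ∈ f.support, monomial m (coeff b (coeff m f))) =
        coeff b (coeff m f) := by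
      intro m
      rw [coeff_sum]
      simp only [coeff_monomial]
      rw [Finset.sum_ite_eq' f.support m]
      split_ifs with hm
      · rfl
      · rw [notMem_support_iff.mp hm, coeff_zero]
    refine eq_zero_of_eval₂_frobenius_eq_zero p t d hd _ (fun m hm => hf m ?_) ?_
    · rw [mem_support_iff, hcoeff] at hm
      rw [mem_support_iff]
      intro h0
      rw [h0, coeff_zero] at hm
      exact hm rfl
    · have h4 := congrArg (coeff (p • b)) h1
      rw [coeff_zero, eval₂_eq, coeff_sum] at h4
      rw [eval₂_sum, ← h4]
      refine Finset.sum_congr rfl fun m _ => ?_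
      rw [eval₂_monomial]
      have h5 : (∏ i ∈ m.support, (C (t i) : MvPolynomial κ F) ^ m i) =
          C (m.prod fun i e => t i ^ e) := by
        simp [Finsupp.prod]
      rw [h5, mul_comm _ (C _), coeff_C_mul, frobenius_def, frobenius_def,
        ← map_frobenius_expand p, coeff_map, coeff_expand_smul p hp.ne_zero, frobenius_def,
        mul_comm]
  ext m b
  have := congrArg (coeff m) (h3 b)
  rw [coeff_sum] at this
  simp only [coeff_monomial] at this
  rw [Finset.sum_ite_eq' f.support m, coeff_zero] at this
  rw [coeff_zero, coeff_zero]
  split_ifs at this with hm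
  · exact this
  · rw [notMem_support_iff.mp hm, coeff_zero]

end MvPolynomial

/-! ### Subfields with a prescribed uniformizer -/

namespace ValuationSubring

variable {M : Type*} [Field M]

/-- The values of the nonzero elements of the subfield `L` are powers of the value of `ϖ`. -/
def IsUniformizedBy (V : ValuationSubring M) (ϖ : M) (L : Subfield M) : Prop :=
  ∀ z ∈ L, z ≠ 0 → ∃ n : ℤ, V.valuation z = V.valuation ϖ ^ n

/-- The condition concerns one element at a time, so it passes to unions of chains and Zorn's lemma
applies. -/
lemma IsUniformizedBy.exists_maximal {V : ValuationSubring M} {ϖ : M} {L₀ : Subfield M}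
    (h : V.IsUniformizedBy ϖ L₀) :
    ∃ L, L₀ ≤ L ∧ Maximal (V.IsUniformizedBy ϖ) L := by
  refine zorn_le_nonempty₀ {L | V.IsUniformizedBy ϖ L} (fun c hc hchain y hy => ?_) L₀ h
  refine ⟨sSup c, fun z hz hz0 => ?_, fun L hL => le_sSup hL⟩
  obtain ⟨L, hL, hzL⟩ := (Subfield.mem_sSup_of_directedOn ⟨y, hy⟩ hchain.directedOn).mp hz
  exact hc hL z hzL hz0

lemma isUnit_comap_subtype_iff (V : ValuationSubring M) (L : Subfield M)
    (b : V.comap L.subtype) : IsUnit b ↔ V.valuation ((b : L) : M) = 1 := by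
  have hb1 : V.valuation ((b : L) : M) ≤ 1 := (V.valuation_le_one_iff _).mpr b.2
  constructor
  · intro hb
    obtain ⟨c, hc⟩ := hb.exists_right_inv
    have hc' : ((b : L) : M) * ((c : L) : M) = 1 :=
      congrArg (fun t : V.comap L.subtype => ((t : L) : M)) hc
    have hc1 : V.valuation ((c : L) : M) ≤ 1 := (V.valuation_le_one_iff _).mpr c.2
    have h1 := congrArg V.valuation hc'
    rw [map_mul, map_one] at h1
    refine le_antisymm hb1 ?_
    rw [← h1]
    exact mul_le_of_le_one_right' hc1
  · intro hb
    have hb0 : (b : L) ≠ 0 := fun h0 => by simp [h0] at hb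
    refine IsUnit.of_mul_eq_one ⟨(b : L)⁻¹, ?_⟩ (Subtype.ext (mul_inv_cancel₀ hb0))
    change L.subtype _ ∈ V
    rw [← V.valuation_le_one_iff, map_inv₀, map_inv₀]
    exact (inv_eq_one.mpr hb).le

lemma mem_maximalIdeal_comap_subtype_iff (V : ValuationSubring M) (L : Subfield M)
    (a : V.comap L.subtype) :
    a ∈ maximalIdeal (V.comap L.subtype) ↔ V.valuation ((a : L) : M) < 1 := by
  have ha : V.valuation ((a : L) : M) ≤ 1 := (V.valuation_le_one_iff _).mpr a.2
  rw [mem_maximalIdeal, _root_.mem_nonunits_iff, isUnit_comap_subtype_iff, ha.lt_iff_ne]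

section

variable {V : ValuationSubring M} {ϖ : M} {L : Subfield M}

/-- Elements of `V ∩ L` are determined up to units by their value, a natural power of that of `ϖ`.
The two conclusions are the input of the criterion for a discrete valuation ring by unit-times-power
factorization. -/
lemma IsUniformizedBy.irreducible_and_associated (h : V.IsUniformizedBy ϖ L) (hϖL : ϖ ∈ L)
    (hϖ0 : ϖ ≠ 0) (hϖ : V.valuation ϖ < 1) (hϖV : (⟨ϖ, hϖL⟩ : L) ∈ V.comap L.subtype) :
    Irreducible (⟨⟨ϖ, hϖL⟩, hϖV⟩ : V.comap L.subtype) ∧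
    ∀ a : V.comap L.subtype, a ≠ 0 →
      ∃ n : ℕ, Associated ((⟨⟨ϖ, hϖL⟩, hϖV⟩ : V.comap L.subtype) ^ n) a := by
  set π : V.comap L.subtype := ⟨⟨ϖ, hϖL⟩, hϖV⟩ with hπ
  have hv0 : 0 < V.valuation ϖ := (Valuation.pos_iff _).mpr hϖ0
  have hpow : ∀ a : V.comap L.subtype, a ≠ 0 →
      ∃ n : ℕ, V.valuation ((a : L) : M) = V.valuation ϖ ^ n := by
    intro a ha
    obtain ⟨n, hn⟩ := h ((a : L) : M) (a : L).2 (fun h0 => ha (Subtype.ext (Subtype.ext h0)))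
    have ha1 : V.valuation ((a : L) : M) ≤ 1 := (V.valuation_le_one_iff _).mpr a.2
    rcases Int.le_total 0 n with h0 | h0
    · obtain ⟨k, rfl⟩ := Int.eq_ofNat_of_zero_le h0
      exact ⟨k, by rw [hn]; exact zpow_natCast _ _⟩
    · obtain ⟨k, hk⟩ := Int.eq_ofNat_of_zero_le (Int.neg_nonneg_of_nonpos h0)
      -- A nonpositive exponent gives a value at least `1`, so the value is exactly `1`.
      refine ⟨0, le_antisymm (by simpa using ha1) ?_⟩
      obtain rfl : n = -(k : ℤ) := by omega
      rw [pow_zero, hn, zpow_neg, zpow_natCast]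
      exact (one_le_inv₀ (pow_pos hv0 k)).mpr (pow_le_one' hϖ.le k)
  constructor
  · refine ⟨fun hu => hϖ.ne ((V.isUnit_comap_subtype_iff L π).mp hu), fun a b hab => ?_⟩
    have hab' : ϖ = ((a : L) : M) * ((b : L) : M) :=
      congrArg (fun t : V.comap L.subtype => ((t : L) : M)) hab
    have ha0 : a ≠ 0 := fun h0 => hϖ0 (by rw [hab', h0]; simp)
    have hb0 : b ≠ 0 := fun h0 => hϖ0 (by rw [hab', h0]; simp)
    obtain ⟨i, hi⟩ := hpow a ha0
    obtain ⟨j, hj⟩ := hpow b hb0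
    have h1 := congrArg V.valuation hab'
    rw [map_mul, hi, hj, ← pow_add] at h1
    have h2 : 1 = i + j := (pow_right_strictAnti₀ hv0 hϖ).injective (by simpa using h1)
    rw [V.isUnit_comap_subtype_iff, V.isUnit_comap_subtype_iff, hi, hj]
    rcases Nat.eq_zero_or_pos i with rfl | hi0
    · exact Or.inl (pow_zero _)
    · obtain rfl : j = 0 := by omega
      exact Or.inr (pow_zero _)
  · intro a ha
    obtain ⟨n, hn⟩ := hpow a ha
    have hw : V.valuation (((a : L) : M) * (ϖ ^ n)⁻¹) = 1 := by
      rw [map_mul, map_inv₀, map_pow, hn]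
      exact mul_inv_cancel₀ (pow_pos hv0 n).ne'
    let w : V.comap L.subtype := ⟨(a : L) * ((⟨ϖ, hϖL⟩ : L) ^ n)⁻¹,
      (V.valuation_le_one_iff _).mp hw.le⟩
    obtain ⟨w', hw'⟩ := (V.isUnit_comap_subtype_iff L w).mpr hw
    refine ⟨n, w', ?_⟩
    rw [hw']
    refine Subtype.ext (Subtype.ext ?_)
    change ϖ ^ n * (((a : L) : M) * (ϖ ^ n)⁻¹) = ((a : L) : M)
    field_simp

end

/-- A prime ideal of a subring of a field is the trace of the maximal ideal of a valuation
subring. -/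
lemma exists_valuation_lt_one_iff {R : Type*} [CommRing R] (f : R →+* M)
    (hf : Function.Injective f) (P : Ideal R) [P.IsPrime] :
    ∃ V : ValuationSubring M, (∀ r, f r ∈ V) ∧ ∀ r, V.valuation (f r) < 1 ↔ r ∈ P := by
  have hunit : ∀ y : P.primeCompl, IsUnit (f y) := fun y => by
    rw [isUnit_iff_ne_zero, Ne, map_eq_zero_iff f hf]
    intro h0
    exact y.2 (h0 ▸ P.zero_mem)
  let g : Localization.AtPrime P →+* M := IsLocalization.lift (M := P.primeCompl) hunit
  have hg : ∀ r, g (algebraMap R _ r) = f r := fun r => IsLocalization.lift_eq hunit r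
  -- A valuation ring of `M` dominating the localization at `P` has the required trace.
  obtain ⟨V, hV, hloc⟩ := IsLocalRing.exists_factor_valuationRing g
  have hmem : ∀ r, f r ∈ V := fun r => hg r ▸ hV _
  refine ⟨V, hmem, fun r => ?_⟩
  rw [← IsLocalization.AtPrime.to_map_mem_maximal_iff (Localization.AtPrime P) P r]
  have h1 : V.valuation (f r) < 1 ↔ (⟨f r, hmem r⟩ : V) ∈ maximalIdeal V :=
    (V.valuation_lt_one_iff ⟨f r, hmem r⟩).symm
  rw [h1, mem_maximalIdeal, mem_maximalIdeal, _root_.mem_nonunits_iff, _root_.mem_nonunits_iff,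
    not_iff_not]
  have h2 : (⟨f r, hmem r⟩ : V) = g.codRestrict V.toSubring hV (algebraMap R _ r) :=
    Subtype.ext (hg r).symm
  constructor
  · intro hu
    rw [h2] at hu
    exact hloc.map_nonunit _ hu
  · intro hu
    rw [h2]
    exact hu.map _

end ValuationSubring

/-- A criterion for the algebraic independence of reductions. -/
lemma IsLocalRing.algebraicIndependent_residue {A W ι : Type*} [CommRing A] [CommRing W]
    [IsLocalRing A] [IsLocalRing W] [Algebra A W] [IsLocalHom (algebraMap A W)] (x : ι → W)
    (h : ∀ Q : MvPolynomial ι A, MvPolynomial.aeval x Q ∈ maximalIdeal W →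
      MvPolynomial.map (residue A) Q = 0) :
    AlgebraicIndependent (ResidueField A) fun i => residue W (x i) := by
  rw [algebraicIndependent_iff]
  intro q hq
  obtain ⟨Q, rfl⟩ := MvPolynomial.map_surjective (residue A) residue_surjective q
  refine h Q ?_
  have hcomp : (residue W).comp (MvPolynomial.aeval x : MvPolynomial ι A →ₐ[A] W).toRingHom =
      (MvPolynomial.aeval (R := ResidueField A) fun i => residue W (x i)).toRingHom.comp
        (MvPolynomial.map (residue A)) := by
    refine MvPolynomial.ringHom_ext (fun a => ?_) fun i => ?_
    · simp
    · simp
  rw [← residue_eq_zero_iff, ← hq]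
  exact congrArg (fun f => f Q) hcomp

namespace ValuationSubring

variable {M : Type*} [Field M] {V : ValuationSubring M} {ϖ : M} {L : Subfield M}

/-- The inclusion of `V ∩ L` into `V`. -/
def comapSubtype (V : ValuationSubring M) (L : Subfield M) : V.comap L.subtype →+* V where
  toFun a := ⟨((a : L) : M), a.2⟩
  map_one' := rfl
  map_mul' _ _ := rfl
  map_zero' := rfl
  map_add' _ _ := rfl

instance (V : ValuationSubring M) (L : Subfield M) : IsLocalHom (V.comapSubtype L) := ⟨fun a ha => by
  rw [V.isUnit_comap_subtype_iff]
  exact (V.valuation_eq_one_iff _).mp ha⟩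

/-- Let `α ∈ V` be such that the reduction of `α` is a root of an irreducible polynomial over the
residue field of `V ∩ L`. A polynomial of smaller degree with coefficients in `V ∩ L` and some
coefficient equal to `1` takes a unit value at `α`. -/
lemma valuation_eval₂_eq_one (α : V) (g : Polynomial (ResidueField (V.comap L.subtype)))
    (hg : Irreducible g) (hgm : g.Monic)
    (hgα : g.eval₂ (ResidueField.map (V.comapSubtype L)) (residue V α) = 0)
    (r : Polynomial (V.comap L.subtype)) (hr : r.degree < g.degree) (i : ℕ) (hi : r.coeff i = 1) :
    V.valuation (r.eval₂ (V.comapSubtype L) α : V) = 1 := by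
  let := (ResidueField.map (V.comapSubtype L)).toAlgebra
  have hmin : g = minpoly _ (residue V α) := minpoly.eq_of_irreducible_of_monic hg hgα hgm
  rw [← V.valuation_eq_one_iff, ← residue_ne_zero_iff_isUnit, Polynomial.hom_eval₂]
  intro h0
  have h1 : Polynomial.aeval (residue V α) (r.map (residue (V.comap L.subtype))) = 0 := by
    rw [Polynomial.aeval_def, Polynomial.eval₂_map, ← h0]
    rfl
  have h2 : r.map (residue (V.comap L.subtype)) ≠ 0 := by
    intro h
    have := congrArg (fun q => q.coeff i) h
    simp [Polynomial.coeff_map, hi] at this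
  have h3 := minpoly.degree_le_of_ne_zero _ _ h2 h1
  rw [← hmin] at h3
  exact absurd (h3.trans Polynomial.degree_map_le) (not_le.mpr hr)

/-- An element of `L(α)` is a polynomial in `α` of degree less than that of `G`. Dividing by a
coefficient of largest value gives a unit of `V` by `valuation_eval₂_eq_one`, so the element has the
value of that coefficient, which lies in `L`. -/
lemma IsUniformizedBy.adjoin (h : V.IsUniformizedBy ϖ L) (α : V)
    (G : Polynomial (V.comap L.subtype)) (hG : G.Monic)
    (hGi : Irreducible (G.map (residue (V.comap L.subtype))))
    (hα : G.eval₂ (V.comapSubtype L) α = 0) :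
    V.IsUniformizedBy ϖ (IntermediateField.adjoin L {(α : M)}).toSubfield := by
  intro z hz hz0
  set H : Polynomial L := G.map (V.comap L.subtype).subtype with hH
  have hHm : H.Monic := hG.map _
  have hHα : Polynomial.aeval (α : M) H = 0 := by
    rw [Polynomial.aeval_def, hH, Polynomial.eval₂_map]
    have := congrArg V.subtype hα
    rw [Polynomial.hom_eval₂, map_zero] at this
    exact this
  have hz' : z ∈ (IntermediateField.adjoin L {(α : M)}).toSubalgebra := hz
  rw [IntermediateField.adjoin_simple_toSubalgebra_of_isAlgebraic ⟨H, hHm.ne_zero, hHα⟩,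
    Algebra.adjoin_singleton_eq_range_aeval] at hz'
  obtain ⟨q₀, hq₀⟩ := hz'
  set q := q₀ %ₘ H with hq
  have hqz : Polynomial.aeval (α : M) q = z := by
    rw [hq, Polynomial.aeval_modByMonic_eq_self_of_root hHα]
    exact hq₀
  have hqd : q.degree < H.degree := Polynomial.degree_modByMonic_lt _ hHm
  have hq0 : q ≠ 0 := by
    rintro h0
    rw [h0, map_zero] at hqz
    exact hz0 hqz.symm
  obtain ⟨i, hi, himax⟩ := Finset.exists_max_image q.support
    (fun j => V.valuation (q.coeff j : M)) (Polynomial.support_nonempty.mpr hq0)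
  set c := q.coeff i with hc
  have hc0 : c ≠ 0 := Polynomial.mem_support_iff.mp hi
  have hc0' : (c : M) ≠ 0 := fun h0 => hc0 (Subtype.ext h0)
  have hvc : 0 < V.valuation (c : M) := (Valuation.pos_iff _).mpr hc0'
  have hlift : Polynomial.C c⁻¹ * q ∈ Polynomial.lifts (V.comap L.subtype).subtype := by
    rw [Polynomial.lifts_iff_coeff_lifts]
    intro j
    have : ((Polynomial.C c⁻¹ * q).coeff j) ∈ V.comap L.subtype := by
      change L.subtype _ ∈ V
      rw [← V.valuation_le_one_iff, Polynomial.coeff_C_mul, map_mul, map_mul, map_inv₀, map_inv₀]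
      by_cases hj : j ∈ q.support
      · exact inv_mul_le_one_of_le₀ (himax j hj) hvc.le
      · rw [Polynomial.notMem_support_iff.mp hj]
        simp
    exact ⟨⟨_, this⟩, rfl⟩
  obtain ⟨r, hr, hrd⟩ := Polynomial.exists_degree_eq_of_mem_lifts hlift
  have hri : r.coeff i = 1 := by
    apply Subtype.ext
    have := congrArg (fun t => t.coeff i) hr
    simp only [Polynomial.coeff_map, Polynomial.coeff_C_mul] at this
    rw [← hc, inv_mul_cancel₀ hc0] at this
    exact this
  have hv := valuation_eval₂_eq_one α _ hGi (hG.map _) (by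
    have := congrArg (residue V) hα
    rw [Polynomial.hom_eval₂, map_zero] at this
    rw [Polynomial.eval₂_map]
    exact this) r (by
      rw [hrd, hG.degree_map, Polynomial.degree_C_mul (inv_ne_zero hc0)]
      rwa [hH, hG.degree_map] at hqd) i hri
  obtain ⟨n, hn⟩ := h (c : M) c.2 hc0'
  refine ⟨n, ?_⟩
  have hzr : ((r.eval₂ (V.comapSubtype L) α : V) : M) = (c : M)⁻¹ * z := by
    change V.subtype _ = _
    rw [Polynomial.hom_eval₂]
    have h1 : Polynomial.aeval (α : M) (r.map (V.comap L.subtype).subtype) = (c : M)⁻¹ * z := by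
      rw [hr, map_mul, Polynomial.aeval_C, hqz, map_inv₀]
      rfl
    rw [Polynomial.aeval_def, Polynomial.eval₂_map] at h1
    exact h1
  rw [hzr, map_mul, map_inv₀, inv_mul_eq_one₀ hvc.ne'] at hv
  rw [← hv, hn]

/-- Lift a monic irreducible polynomial over the residue field to a monic `G`. A root of `G` in `M`
is integral, hence in `V`; adjoining it preserves the uniformizer, so by maximality it is already in
`L`, and it reduces to a root. -/
lemma IsUniformizedBy.isAlgClosed_residueField [IsAlgClosed M]
    (h : Maximal (V.IsUniformizedBy ϖ) L) : IsAlgClosed (ResidueField (V.comap L.subtype)) := by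
  refine IsAlgClosed.of_exists_root _ fun g hgm hg => ?_
  obtain ⟨G, hGg, hGd, hG⟩ := Polynomial.lifts_and_natDegree_eq_and_monic
    ((Polynomial.mem_lifts g).mpr (Polynomial.map_surjective _ residue_surjective g)) hgm
  have hdeg : (G.map ((V.subtype).comp (V.comapSubtype L))).degree ≠ 0 := by
    rw [hG.degree_map, ← hG.degree_map (residue (V.comap L.subtype)), hGg]
    exact hg.degree_pos.ne'
  obtain ⟨α, hα⟩ := IsAlgClosed.exists_root _ hdeg
  have hαV : α ∈ V := by
    have hint : IsIntegral V α := ⟨G.map (V.comapSubtype L), hG.map _, by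
      rw [Polynomial.eval₂_map]
      rwa [Polynomial.IsRoot, Polynomial.eval_map] at hα⟩
    obtain ⟨y, rfl⟩ := IsIntegrallyClosed.isIntegral_iff.mp hint
    exact y.2
  have hα' : G.eval₂ (V.comapSubtype L) (⟨α, hαV⟩ : V) = 0 := by
    apply Subtype.val_injective
    change V.subtype _ = 0
    rw [Polynomial.hom_eval₂]
    rwa [Polynomial.IsRoot, Polynomial.eval_map] at hα
  have hle := h.2 (h.1.adjoin ⟨α, hαV⟩ G hG (hGg ▸ hg) hα') (fun x hx =>
    (IntermediateField.adjoin L {α}).algebraMap_mem ⟨x, hx⟩)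
  have hαL : α ∈ L := hle (IntermediateField.mem_adjoin_simple_self L α)
  let a : V.comap L.subtype := ⟨⟨α, hαL⟩, hαV⟩
  have ha : G.eval a = 0 := by
    have h1 : V.comapSubtype L (G.eval a) = 0 := by
      rw [← Polynomial.eval₂_at_apply]
      exact hα'
    exact Subtype.ext (Subtype.ext (congrArg V.subtype h1))
  refine ⟨residue _ a, ?_⟩
  rw [← hGg, Polynomial.eval_map, Polynomial.eval₂_at_apply, ha, map_zero]

end ValuationSubring

/-! ### Adjoining `x i` and `p`-th roots of `s i - ϖ * x i` -/

namespace MvPolynomial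

/-- If the `p`-th powers of the `u i` are values of constants, every value of a polynomial at `u`
is the value of a polynomial of degree less than `p` in each variable. -/
lemma exists_eval₂_eq_of_pow_eq {R S ι : Type*} [CommRing R] [CommRing S] (φ : R →+* S)
    (u : ι → S) (p : ℕ) (hp : 0 < p) (c : ι → R) (hu : ∀ i, u i ^ p = φ (c i))
    (f : MvPolynomial ι R) :
    ∃ g : MvPolynomial ι R, (∀ m ∈ g.support, ∀ i, m i < p) ∧ eval₂ φ u g = eval₂ φ u f := by
  classical
  induction f using MvPolynomial.induction_on' with
  | add f g hf hg =>
    obtain ⟨f', hf', hf⟩ := hf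
    obtain ⟨g', hg', hg⟩ := hg
    refine ⟨f' + g', fun m hm => ?_, by rw [eval₂_add, eval₂_add, hf, hg]⟩
    rcases Finset.mem_union.mp (support_add hm) with h | h
    exacts [hf' m h, hg' m h]
  | monomial m a =>
    -- Exponents are reduced modulo `p`; the quotients `e / p` are absorbed into the coefficient as
    -- powers of `c i`.
    let r : ι →₀ ℕ := m.mapRange (· % p) (Nat.zero_mod p)
    refine ⟨monomial r (a * m.prod fun i e => c i ^ (e / p)), fun m' hm' i => ?_, ?_⟩
    · rw [Finset.mem_singleton.mp (support_monomial_subset hm')]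
      exact Nat.mod_lt _ hp
    · have hr : (r.prod fun i e => u i ^ e) = m.prod fun i e => u i ^ (e % p) := by
        rw [Finsupp.prod_mapRange_index]
        simp
      rw [eval₂_monomial, eval₂_monomial, map_mul, hr, mul_assoc]
      congr 1
      rw [Finsupp.prod, Finsupp.prod, Finsupp.prod, map_prod, ← Finset.prod_mul_distrib]
      refine Finset.prod_congr rfl fun i _ => ?_
      rw [map_pow, ← hu, ← pow_mul, ← pow_add, Nat.div_add_mod]

/-- Divide a nonzero polynomial by the maximal power of a constant. -/
lemma exists_eq_C_pow_mul {R ι : Type*} [CommRing R] [IsDomain R] [UniqueFactorizationMonoid R]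
    {π : R} (hπ : ¬ IsUnit π) {f : MvPolynomial ι R} (hf : f ≠ 0) :
    ∃ (n : ℕ) (g : MvPolynomial ι R), ¬ C π ∣ g ∧ f = C (π ^ n) * g := by
  have hπ' : ¬ IsUnit (C π : MvPolynomial ι R) := fun h =>
    hπ (by simpa using h.map constantCoeff)
  obtain ⟨n, g, hg, hfg⟩ := WfDvdMonoid.max_power_factor' hf hπ'
  exact ⟨n, g, hg, by rw [hfg, C_pow]⟩

end MvPolynomial

open MvPolynomial in
/-- Let `V` dominate `O[x]` localized at the prime ideal generated by `ϖ`, and let `u i` be a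
`p`-th root of `s i - ϖ * x i`, where the reductions of the `s i` are `p`-independent. Then `ϖ` is
a uniformizer of the field generated by `x` and `u`. -/
theorem ValuationSubring.isUniformizedBy_closure {M O ι : Type*} [Field M] [CommRing O] [IsDomain O]
    [IsDiscreteValuationRing O] (p : ℕ) [Fact p.Prime] [CharP (ResidueField O) p] [DecidableEq ι]
    (ϖ : O) (hϖ : Irreducible ϖ) (s : ι → O) (d : ι → Derivation ℤ (ResidueField O) (ResidueField O))
    (hd : ∀ i j, d i (residue O (s j)) = if j = i then 1 else 0)
    (V : ValuationSubring M) (φ : MvPolynomial ι O →+* M) (hφV : ∀ r, φ r ∈ V)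
    (hφ : ∀ r, V.valuation (φ r) < 1 ↔ MvPolynomial.map (residue O) r = 0)
    (hϖφ : φ (C ϖ) ≠ 0) (u : ι → M) (hu : ∀ i, u i ^ p = φ (C (s i) - C ϖ * X i)) :
    V.IsUniformizedBy (φ (C ϖ)) (Subfield.closure (eval₂Hom φ u).range) := by
  have hp : p.Prime := Fact.out
  have hϖ0 : residue O ϖ = 0 := (residue_eq_zero_iff ϖ).mpr hϖ.not_isUnit
  have huV : ∀ i, u i ∈ V := by
    intro i
    have h1 := (V.valuation_le_one_iff _).mpr (hφV (C (s i) - C ϖ * X i))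
    rw [← hu, map_pow] at h1
    exact (V.valuation_le_one_iff _).mp ((pow_le_one_iff hp.ne_zero).mp h1)
  let φV : MvPolynomial ι O →+* V := φ.codRestrict V.toSubring hφV
  let uV : ι → V := fun i => ⟨u i, huV i⟩
  have hφVm : ∀ r, φV r ∈ maximalIdeal V ↔ MvPolynomial.map (residue O) r = 0 := fun r => by
    rw [← hφ]
    exact V.valuation_lt_one_iff (φV r)
  let : Algebra O V := (φV.comp C).toAlgebra
  have hOV : ∀ a, algebraMap O V a = φV (C a) := fun a => rfl
  have : IsLocalHom (algebraMap O V) := ⟨fun a ha => by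
    by_contra h
    have h1 : φV (C a) ∈ maximalIdeal V := by
      rw [hφVm, map_C, (residue_eq_zero_iff a).mpr h, C_0]
    exact h1 ha⟩
  let xV : ι → V := fun i => φV (X i)
  have haeval : ∀ Q : MvPolynomial ι O, aeval xV Q = φV Q := by
    intro Q
    have : (aeval xV : MvPolynomial ι O →ₐ[O] V).toRingHom = φV :=
      ringHom_ext (fun a => by simp [hOV]) fun i => by simp [xV]
    exact congrArg (fun f => f Q) this
  have hx := algebraicIndependent_residue (A := O) xV fun Q hQ => by
    rwa [haeval, hφVm] at hQ
  have hu' : ∀ i, residue V (uV i) ^ p =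
      algebraMap (ResidueField O) (ResidueField V) (residue O (s i)) := by
    intro i
    have h1 : uV i ^ p = φV (C (s i)) - φV (C ϖ) * xV i := by
      apply Subtype.ext
      change u i ^ p = φ _ - φ _ * φ _
      rw [hu, map_sub, map_mul]
    have h2 : residue V (φV (C ϖ)) = 0 := by
      rw [residue_eq_zero_iff, hφVm, map_C, hϖ0, C_0]
    rw [← map_pow, h1, map_sub, map_mul, h2, zero_mul, sub_zero]
    rfl
  -- Lower the degrees in `u` below `p`, then pull out the largest power of `ϖ`. The cofactor is
  -- nonzero modulo `ϖ`, so by `eq_zero_of_eval₂_aeval_eq_zero` its value has nonzero residue and is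
  -- a unit of `V`.
  have hval : ∀ f : MvPolynomial ι (MvPolynomial ι O), eval₂ φ u f ≠ 0 →
      ∃ n : ℕ, V.valuation (eval₂ φ u f) = V.valuation (φ (C ϖ)) ^ n := by
    intro f₀ hf₀
    obtain ⟨f, hf, hff⟩ := exists_eval₂_eq_of_pow_eq φ u p hp.pos _ hu f₀
    rw [← hff] at hf₀ ⊢
    have hf0 : f ≠ 0 := by
      rintro rfl
      simp at hf₀
    have hCϖ : ¬ IsUnit (C ϖ : MvPolynomial ι O) := fun h =>
      hϖ.not_isUnit (by simpa using h.map constantCoeff)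
    obtain ⟨n, g, hg, hfg⟩ := exists_eq_C_pow_mul hCϖ hf0
    have hgred : ∀ m ∈ g.support, ∀ i, m i < p := by
      intro m hm
      refine hf m ?_
      rw [mem_support_iff] at hm ⊢
      rw [hfg, coeff_C_mul]
      exact mul_ne_zero (pow_ne_zero _ (C_ne_zero.mpr hϖ.ne_zero)) hm
    let r : MvPolynomial ι O →+* MvPolynomial ι (ResidueField O) := MvPolynomial.map (residue O)
    have hr0 : ∀ q, r q = 0 ↔ C ϖ ∣ q := fun q => by
      rw [C_dvd_iff_map_hom_eq_zero (residue O) ϖ fun a => ?_]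
      rw [residue_eq_zero_iff, hϖ.maximalIdeal_eq, Ideal.mem_span_singleton]
    have hg0 : MvPolynomial.map r g ≠ 0 := by
      rwa [Ne, ← C_dvd_iff_map_hom_eq_zero r (C ϖ) hr0]
    have hgr : ∀ m ∈ (MvPolynomial.map r g).support, ∀ i, m i < p := fun m hm =>
      hgred m (support_map_subset _ _ hm)
    have hne := fun h => hg0 (eq_zero_of_eval₂_aeval_eq_zero p _ d hd
      (fun i => residue V (uV i)) hu' _ hx (MvPolynomial.map r g) hgr h)
    have hcomp : (residue V).comp (eval₂Hom φV uV) =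
        (eval₂Hom (aeval (R := ResidueField O) fun i => residue V (xV i)).toRingHom
          fun i => residue V (uV i)).comp (MvPolynomial.map r) := by
      refine ringHom_ext (fun q => ?_) fun i => by simp
      have : (residue V).comp φV =
          (aeval (R := ResidueField O) fun i => residue V (xV i)).toRingHom.comp r := by
        refine ringHom_ext (fun a => ?_) fun i => by simp [r, xV]
        simp [r]
        rfl
      simpa using congrArg (fun f => f q) this
    have hgV : residue V (eval₂Hom φV uV g) ≠ 0 := fun h0 =>
      hne ((congrArg (fun f => f g) hcomp).symm.trans h0)
    have hval1 : V.valuation (eval₂ φ u g) = 1 := by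
      rw [residue_ne_zero_iff_isUnit, V.valuation_eq_one_iff] at hgV
      have h1 : ((eval₂Hom φV uV g : V) : M) = eval₂ φ u g := by
        change V.subtype _ = _
        rw [coe_eval₂Hom, hom_eval₂]
        rfl
      rwa [h1] at hgV
    refine ⟨n, ?_⟩
    rw [hfg, eval₂_mul, eval₂_C, map_mul, hval1, mul_one, map_pow, map_pow]
  intro z hz hz0
  rw [Subfield.mem_closure_iff] at hz
  obtain ⟨a, ha, b, hb, rfl⟩ := hz
  rw [Subring.closure_eq] at ha hb
  obtain ⟨f, rfl⟩ := ha
  obtain ⟨g, rfl⟩ := hb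
  obtain ⟨m, hm⟩ := hval f (fun h0 => hz0 (by rw [coe_eval₂Hom, h0, zero_div]))
  obtain ⟨n, hn⟩ := hval g (fun h0 => hz0 (by rw [coe_eval₂Hom, h0, div_zero]))
  have hv0 : V.valuation (φ (C ϖ)) ≠ 0 := (Valuation.ne_zero_iff _).mpr hϖφ
  refine ⟨m - n, ?_⟩
  rw [map_div₀, coe_eval₂Hom, hm, hn, zpow_sub₀ hv0, zpow_natCast, zpow_natCast]

/-! ### Isomorphisms, for residue characteristic zero -/

/-- `tangentAlgebraMap` has a left inverse if the rings of the commutative square can be mapped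
back compatibly. -/
lemma tangentAlgebraMap_leftInverse (A B E E' : Type*) [CommRing A] [CommRing B] [CommRing E]
    [CommRing E'] [Algebra A B] [Algebra A E] [Algebra B E'] [Algebra E E'] [Algebra A E']
    [IsScalarTower A B E'] [IsScalarTower A E E'] [Algebra B A] [Algebra E' E] [Algebra B E]
    [IsScalarTower B A E] [IsScalarTower B E' E] [IsScalarTower A B A] [IsScalarTower E E' E] :
    Function.LeftInverse (tangentAlgebraMap B A E' E) (tangentAlgebraMap A B E E') := by
  have hH : ∀ m, Algebra.H1Cotangent.map B A E' E (Algebra.H1Cotangent.map A B E E' m) = m := by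
    intro m
    rw [Algebra.H1Cotangent.map, Algebra.H1Cotangent.map,
      ← Algebra.Extension.H1Cotangent.map_comp_apply, Algebra.Extension.H1Cotangent.map_eq,
      Algebra.Extension.H1Cotangent.map_id, LinearMap.id_apply]
  intro z
  induction z using SymmetricAlgebra.induction with
  | algebraMap r =>
    rw [AlgHom.commutes, IsScalarTower.algebraMap_apply E E' (SymmetricAlgebra E' _),
      AlgHom.commutes, IsScalarTower.algebraMap_apply E' E (SymmetricAlgebra E _),
      ← IsScalarTower.algebraMap_apply E E' E]
    rfl
  | ι m =>
    simp only [tangentAlgebraMap, SymmetricAlgebra.lift_ι_apply, LinearMap.comp_apply,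
      LinearMap.restrictScalars_apply, hH]
  | mul a b ha hb => rw [map_mul, map_mul, ha, hb]
  | add a b ha hb => rw [map_add, map_add, ha, hb]

/-- An isomorphism of local rings is tangentially dominant. -/
theorem isTangentiallyDominant_of_bijective {A : Type u} {B : Type v} [CommRing A] [CommRing B]
    [IsLocalRing A] [IsLocalRing B] [Algebra A B] [IsLocalHom (algebraMap A B)]
    (h : Function.Bijective (algebraMap A B)) : IsTangentiallyDominant A B := by
  intro E E' _ _ _ _ _ _ _ _ _ _ _ _ _ _ _ _ _
  have : IsAlgClosed E := IsAlgClosure.isAlgClosed (ResidueField A)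
  have : Algebra.IsAlgebraic (ResidueField B) E' := IsAlgClosure.isAlgebraic
  have hF : Function.Surjective (algebraMap (ResidueField A) (ResidueField B)) := by
    intro y
    obtain ⟨b, rfl⟩ := residue_surjective y
    obtain ⟨a, rfl⟩ := h.2 b
    exact ⟨residue A a, rfl⟩
  -- Integrality makes `E'` integral over the algebraically closed field `E`, so `E → E'` is
  -- bijective and the whole square can be inverted.
  have : Algebra.IsIntegral (ResidueField A) (ResidueField B) :=
    Algebra.IsIntegral.of_surjective (Algebra.ofId _ _) hF
  have : Algebra.IsIntegral (ResidueField A) E' := Algebra.IsIntegral.trans (ResidueField B)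
  have : Algebra.IsIntegral E E' := Algebra.IsIntegral.tower_top (R := ResidueField A)
  have hE : Function.Bijective (algebraMap E E') := IsAlgClosed.algebraMap_bijective_of_isIntegral
  let eA := RingEquiv.ofBijective (algebraMap A B) h
  let eE := RingEquiv.ofBijective (algebraMap E E') hE
  let : Algebra B A := eA.symm.toRingHom.toAlgebra
  let : Algebra E' E := eE.symm.toRingHom.toAlgebra
  let : Algebra B E := ((algebraMap A E).comp eA.symm.toRingHom).toAlgebra
  have : IsScalarTower B A E := .of_algebraMap_eq fun _ => rfl
  have : IsScalarTower A B A := .of_algebraMap_eq fun a => (eA.symm_apply_apply a).symm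
  have : IsScalarTower E E' E := .of_algebraMap_eq fun a => (eE.symm_apply_apply a).symm
  have : IsScalarTower B E' E := .of_algebraMap_eq fun b => by
    obtain ⟨a, rfl⟩ := h.2 b
    have h1 : algebraMap B E (algebraMap A B a) = algebraMap A E a :=
      congrArg (algebraMap A E) (eA.symm_apply_apply a)
    rw [h1, ← IsScalarTower.algebraMap_apply A B E', IsScalarTower.algebraMap_apply A E E']
    exact (eE.symm_apply_apply _).symm
  exact (tangentAlgebraMap_leftInverse A B E E').injective

/-! ### Construction of the extension -/

/-- A family in a field whose differentials form a basis of the absolute differentials, together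
with the dual family of derivations. -/
lemma exists_differential_basis (F : Type u) [Field F] :
    ∃ (ι : Type u) (_ : DecidableEq ι) (t : ι → F) (d : ι → Derivation ℤ F F),
      Submodule.span F (Set.range fun i => KaehlerDifferential.D ℤ F (t i)) = ⊤ ∧
      ∀ i j, d i (t j) = if j = i then 1 else 0 := by
  classical
  obtain ⟨b, hb, hspan, hli⟩ := exists_linearIndependent F (Set.range (KaehlerDifferential.D ℤ F))
  rw [KaehlerDifferential.span_range_derivation] at hspan
  choose t ht using fun i : b => hb i.2
  have hrange : Set.range (fun i : b => KaehlerDifferential.D ℤ F (t i)) = b := by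
    simp only [ht, Subtype.range_coe]
  let B : Module.Basis b F (Ω[F⁄ℤ]) := Module.Basis.mk hli (by rw [Subtype.range_coe, hspan])
  refine ⟨b, inferInstance, t, fun i => (B.coord i).compDer (KaehlerDifferential.D ℤ F),
    by rw [hrange, hspan], fun i j => ?_⟩
  have h1 : KaehlerDifferential.D ℤ F (t j) = B j := by
    rw [ht, Module.Basis.mk_apply]
  change B.coord i (KaehlerDifferential.D ℤ F (t j)) = _
  rw [h1, Module.Basis.coord_apply, Module.Basis.repr_self, Finsupp.single_apply]

/-- A discrete valuation ring with residue field of characteristic `p` admits a tangentially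
dominant extension of ramification index one with algebraically closed residue field. -/
theorem exists_isTangentiallyDominant_of_charP (O : Type u) [CommRing O] [IsDomain O]
    [IsDiscreteValuationRing O] (p : ℕ) [Fact p.Prime] [CharP (ResidueField O) p] :
    ∃ (K' : Type u) (_ : Field K') (O' : Type u) (_ : CommRing O') (_ : IsDomain O')
      (_ : IsDiscreteValuationRing O') (_ : Algebra O' K') (_ : IsFractionRing O' K')
      (_ : Algebra O O') (_ : IsLocalHom (algebraMap O O')),
      Module.FaithfullyFlat O O' ∧ IsTangentiallyDominant O O' ∧
      IsAlgClosed (ResidueField O') := by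
  obtain ⟨ι, _, t, d, ht, hd⟩ := exists_differential_basis (ResidueField O)
  choose s hs using fun i => residue_surjective (t i)
  obtain rfl : t = fun i => residue O (s i) := funext fun i => (hs i).symm
  obtain ⟨ϖ, hϖ⟩ := IsDiscreteValuationRing.exists_irreducible O
  let Q := FractionRing (MvPolynomial ι O)
  let M := AlgebraicClosure Q
  let φ : MvPolynomial ι O →+* M := (algebraMap Q M).comp (algebraMap _ Q)
  have hφinj : Function.Injective φ :=
    (algebraMap Q M).injective.comp (IsFractionRing.injective (MvPolynomial ι O) Q)
  have hϖφ : φ (MvPolynomial.C ϖ) ≠ 0 := by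
    rw [Ne, map_eq_zero_iff φ hφinj, MvPolynomial.C_eq_zero]
    exact hϖ.ne_zero
  have := RingHom.ker_isPrime (MvPolynomial.map (σ := ι) (residue O))
  -- The prime is the ideal generated by `ϖ` in the polynomial ring, so the `x i` have algebraically
  -- independent reductions. Discreteness is only obtained after restriction to a subfield `L`.
  obtain ⟨V, hφV, hφ⟩ := ValuationSubring.exists_valuation_lt_one_iff φ hφinj
    (RingHom.ker (MvPolynomial.map (σ := ι) (residue O)))
  choose u hu using fun i => IsAlgClosed.exists_pow_nat_eq
    (φ (MvPolynomial.C (s i) - MvPolynomial.C ϖ * MvPolynomial.X i)) (Fact.out : p.Prime).pos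
  have hU := V.isUniformizedBy_closure p ϖ hϖ s d hd φ hφV hφ hϖφ u hu
  obtain ⟨L, hL₀, hL⟩ := hU.exists_maximal
  have hφL : ∀ r, φ r ∈ L := fun r => hL₀ (Subfield.subset_closure
    ⟨MvPolynomial.C r, by rw [MvPolynomial.eval₂Hom_C]⟩)
  have huL : ∀ i, u i ∈ L := fun i => hL₀ (Subfield.subset_closure
    ⟨MvPolynomial.X i, by rw [MvPolynomial.eval₂Hom_X']⟩)
  have huV : ∀ i, u i ∈ V := by
    intro i
    have h1 := (V.valuation_le_one_iff _).mpr (hφV (MvPolynomial.C (s i) -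
      MvPolynomial.C ϖ * MvPolynomial.X i))
    rw [← hu, map_pow] at h1
    exact (V.valuation_le_one_iff _).mp
      ((pow_le_one_iff (Fact.out : p.Prime).ne_zero).mp h1)
  let O' := V.comap L.subtype
  let ψ : MvPolynomial ι O →+* O' := (φ.codRestrict L hφL).codRestrict O'.toSubring hφV
  let : Algebra O O' := (ψ.comp MvPolynomial.C).toAlgebra
  have hψ : ∀ r, ψ r ∈ maximalIdeal O' ↔ MvPolynomial.map (residue O) r = 0 := fun r => by
    rw [V.mem_maximalIdeal_comap_subtype_iff]
    exact hφ r
  have hOO' : ∀ a, algebraMap O O' a = ψ (MvPolynomial.C a) := fun a => rfl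
  have hloc : IsLocalHom (algebraMap O O') := ⟨fun a ha => by
    by_contra h
    have h1 : ψ (MvPolynomial.C a) ∈ maximalIdeal O' := by
      rw [hψ, MvPolynomial.map_C, (residue_eq_zero_iff a).mpr h, MvPolynomial.C_0]
    exact h1 ha⟩
  have hϖ1 : V.valuation (φ (MvPolynomial.C ϖ)) < 1 := by
    rw [hφ, RingHom.mem_ker, MvPolynomial.map_C, (residue_eq_zero_iff ϖ).mpr hϖ.not_isUnit,
      MvPolynomial.C_0]
  obtain ⟨hirr, hassoc⟩ := hL.1.irreducible_and_associated (hφL _) hϖφ hϖ1 (hφV _)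
  have hirr' : Irreducible (algebraMap O O' ϖ) := hirr
  have hdvr : IsDiscreteValuationRing O' :=
    IsDiscreteValuationRing.ofHasUnitMulPowIrreducibleFactorization
      ⟨_, hirr, fun {a} ha => hassoc a ha⟩
  have halg : IsAlgClosed (ResidueField O') :=
    ValuationSubring.IsUniformizedBy.isAlgClosed_residueField hL
  have hinj : Function.Injective (algebraMap O O') := by
    intro a b hab
    have : φ (MvPolynomial.C a) = φ (MvPolynomial.C b) :=
      congrArg (fun z : O' => ((z : L) : M)) hab
    exact MvPolynomial.C_injective ι O (hφinj this)
  have htf : Module.IsTorsionFree O O' := Module.isTorsionFree_iff_algebraMap_injective.mpr hinj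
  -- Torsion-free over a discrete valuation ring gives flat; the local homomorphism makes it
  -- faithful.
  have hflat : Module.FaithfullyFlat O O' := Module.FaithfullyFlat.of_flat_of_isLocalHom
  refine ⟨L, inferInstance, O', inferInstance, inferInstance, hdvr, inferInstance, inferInstance,
    inferInstance, hloc, hflat, ?_, halg⟩
  let x' : ι → O' := fun i => ψ (MvPolynomial.X i)
  have haeval : ∀ r : MvPolynomial ι O, MvPolynomial.aeval x' r = ψ r := by
    intro r
    have : (MvPolynomial.aeval x' : MvPolynomial ι O →ₐ[O] O').toRingHom = ψ :=
      MvPolynomial.ringHom_ext (fun a => by simp [hOO']) fun i => by simp [x']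
    exact congrArg (fun f => f r) this
  refine isTangentiallyDominant_of_algebraicIndependent p ϖ hϖ.maximalIdeal_eq ?_ s x'
    (fun i => ⟨⟨u i, huL i⟩, huV i⟩) ht ?_ fun i => ?_
  · rw [hirr'.maximalIdeal_eq, Ideal.span_singleton_pow, Ideal.mem_span_singleton]
    rintro ⟨c, hc⟩
    have h1 : algebraMap O O' ϖ * c = 1 := by
      apply mul_left_cancel₀ hirr'.ne_zero
      rw [mul_one, ← mul_assoc, ← pow_two]
      exact hc.symm
    exact hirr'.not_isUnit (IsUnit.of_mul_eq_one _ h1)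
  · refine algebraicIndependent_residue (A := O) x' fun r hr => ?_
    rwa [haeval, hψ] at hr
  · apply Subtype.ext
    apply Subtype.ext
    change φ (MvPolynomial.C (s i)) =
      u i ^ p + φ (MvPolynomial.C ϖ) * φ (MvPolynomial.X i)
    rw [hu, map_sub, map_mul, sub_add_cancel]

theorem proposition1p8 (K : Type v) [Field K] (OK : Type u) [CommRing OK] [IsDomain OK]
    [IsDiscreteValuationRing OK] [Algebra OK K] [IsFractionRing OK K] :
    ∃ (K' : Type u) (_ : Field K') (OK' : Type u) (_ : CommRing OK') (_ : IsDomain OK')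
      (_ : IsDiscreteValuationRing OK') (_ : Algebra OK' K') (_ : IsFractionRing OK' K')
      (_ : Algebra OK OK') (_ : IsLocalHom (algebraMap OK OK')),
      Module.FaithfullyFlat OK OK' ∧
      IsTangentiallyDominant OK OK' ∧
      PerfectField (IsLocalRing.ResidueField OK') := by
  obtain ⟨p, hp⟩ := CharP.exists (ResidueField OK)
  rcases CharP.char_is_prime_or_zero (ResidueField OK) p with hprime | rfl
  · have : Fact p.Prime := ⟨hprime⟩
    obtain ⟨K', i₁, O', i₂, i₃, i₄, i₅, i₆, i₇, i₈, h₁, h₂, h₃⟩ :=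
      exists_isTangentiallyDominant_of_charP OK p
    exact ⟨K', i₁, O', i₂, i₃, i₄, i₅, i₆, i₇, i₈, h₁, h₂, inferInstance⟩
  · have : CharZero (ResidueField OK) := CharP.charP_to_charZero _
    have hloc : IsLocalHom (algebraMap OK OK) := ⟨fun a ha => ha⟩
    -- `K` may live in another universe than `OK`, so `FractionRing OK` takes its place.
    exact ⟨FractionRing OK, inferInstance, OK, inferInstance, inferInstance, inferInstance,
      inferInstance, inferInstance, inferInstance, hloc, inferInstance,
      isTangentiallyDominant_of_bijective Function.bijective_id, inferInstance⟩
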